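/- Let $G$ be a finite nonabelian group and let $\Gamma_G$ be its noncommuting graph: the vertex set is $V=G\setminus Z(G)$, and $x\sim y$ if and only if $xy\neq yx$. Give every edge the weight $\sigma_{xy}=1$, so that $\mu_x=\deg x$; for $A\subseteq V$ put $\mu(A)=\sum_{x\in A}\deg x$ and let $\partial A$ be the set of edges joining $A$ to $V\setminus A$. Let $\rho_\xi(x)$ be the graph distance from $\xi$ to $x$, let $\mu^\xi_x$ be the number of neighbours $y$ of $x$ with $\rho_\xi(y)<\rho_\xi(x)$, and let $$\nu_2=\inf\Big\{\tfrac{\mu_x}{\mu^\xi_x}\ \Big|\ \xi,x\in V,\ \rho_\xi(x)<2\Big\},$$ where a ratio with $\mu^\xi_x=0$ counts as $+\infty$. Put $n=\nu_2$, $\omega=\min_{x\in V}\deg x$ and $$c=\frac{\omega^{\frac1{n-1}}}{4^{n+3}\,\nu_2\,e^{2n}}.$$ There are constants $C(n,p)>0$, depending only on $n$ and $p$ (and not otherwise on $G$), such that the following holds for every such $G$. One has $n>1$ and $c>0$, and for every proper subset $\Omega\subsetneq V$: (a) $|\partial\Omega|\ge c\,\mu(\Omega)^{1-\frac1n}$;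 (b) with $v_0=1+\sum_{x\in\Omega}\deg x$, for every real $p$ with $0<p<n$ and every $f:V\to\mathbb{R}$, $$C(n,p)\Big(\sum_{x\in V}\ \sum_{y\sim x}|f(y)-f(x)|^p\Big)^{\frac1p}+c\,K(\Omega_0)\Big(\sum_{x\in V}|f(x)|^p\deg x\Big)^{\frac1p}\ \ge\ \frac{c}{2^{1+\frac1n-\frac1p}}\Big(\sum_{x\in V}|f(x)|^{\frac{np}{n-p}}\Big)^{\frac{n-p}{np}},$$ where $\Omega_0=\{x\in V : |f(x)|>0\}$, and $K(\Omega_0)=0$ if $\mu(\Omega_0)\le v_0$, while $K(\Omega_0)=v_0^{-1}\mu(\Omega_0)^{1-\frac1n}$ if $\mu(\Omega_0)>v_0$. -/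

import Mathlib

/-- A weighted graph: a simple graph with a symmetric edge weight `σ x y`, positive on the edges
and extended by zero to the pairs of vertices that are not adjacent. -/
structure WeightedGraph (V : Type*) where
  graph : SimpleGraph V
  σ : V → V → ℝ
  σ_symm : ∀ x y, σ x y = σ y x
  σ_pos : ∀ x y, graph.Adj x y → 0 < σ x y
  σ_zero : ∀ x y, ¬ graph.Adj x y → σ x y = 0

namespace WeightedGraph

open Classical in
/-- The weighted graph with all edge weights equal to `1`. -/
noncomputable def unit {V : Type*} (H : SimpleGraph V) : WeightedGraph V where
  graph := H
  σ x y := if H.Adj x y then 1 else 0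
  σ_symm x y := by simp [H.adj_comm x y]
  σ_pos x y h := by simp [h]
  σ_zero x y h := by simp [h]

variable {V : Type*} [Fintype V] (Γ : WeightedGraph V)

open Classical in
/-- The vertex weight `μ_x`, the sum of `σ x y` over the neighbours `y` of `x`. -/
noncomputable def vertexWeight (x : V) : ℝ :=
  ∑ y with Γ.graph.Adj x y, Γ.σ x y

/-- The measure `μ(Ω)` of a set of vertices. -/
noncomputable def measure (Ω : Finset V) : ℝ :=
  ∑ x ∈ Ω, Γ.vertexWeight x

open Classical in
/-- The edge boundary `∂Ω`: every edge joining a vertex of `Ω` to a vertex outside `Ω`, taken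
once, with its orientation pointing outwards from `Ω`. -/
noncomputable def boundary (Ω : Finset V) : Finset (V × V) :=
  {e | e.1 ∈ Ω ∧ e.2 ∉ Ω ∧ Γ.graph.Adj e.1 e.2}

/-- The total weight `σ(∂Ω)` of the edge boundary. -/
noncomputable def boundaryWeight (Ω : Finset V) : ℝ :=
  ∑ e ∈ Γ.boundary Ω, Γ.σ e.1 e.2

open Classical in
/-- `μ^ξ_x`: the sum of `σ x y` over the neighbours `y` of `x` that are strictly closer to `ξ`
than `x` is, in the graph distance. -/
noncomputable def inwardWeight (ξ x : V) : ℝ :=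
  ∑ y with Γ.graph.Adj x y ∧ Γ.graph.edist ξ y < Γ.graph.edist ξ x, Γ.σ x y

/-- The open ball `B_ξ(r)` of the graph distance, which takes values in `ℕ ∪ {∞}`. -/
def ball (ξ : V) (r : ℕ) : Set V :=
  {x | Γ.graph.edist ξ x < r}

/-- `ν_r`, the infimum of the ratios `μ_x / μ^ξ_x` over all vertices `ξ` and all `x` in `B_ξ(r)`.
A ratio with `μ^ξ_x = 0` (for instance when `x = ξ`) is `+∞` and does not contribute. -/
noncomputable def nu (r : ℕ) : ℝ :=
  sInf {t | ∃ ξ x : V, x ∈ Γ.ball ξ r ∧ 0 < Γ.inwardWeight ξ x ∧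
    t = Γ.vertexWeight x / Γ.inwardWeight ξ x}

/-- `ω`, the infimum of the vertex weights. -/
noncomputable def minVertexWeight : ℝ :=
  sInf {t | ∃ x : V, t = Γ.vertexWeight x}

/-- `ω'`, the infimum of the edge weights. -/
noncomputable def minEdgeWeight : ℝ :=
  sInf {t | ∃ x y : V, Γ.graph.Adj x y ∧ t = Γ.σ x y}

/-- The constant `c = ω' ω^(1/(n-1)) / (4^(n+3) ν_{R₀+1} ι e^(2n))`. -/
noncomputable def isoConst (R₀ : ℕ) (ι n : ℝ) : ℝ :=
  Γ.minEdgeWeight * Γ.minVertexWeight ^ (1 / (n - 1)) /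
    ((4 : ℝ) ^ (n + 3) * Γ.nu (R₀ + 1) * ι * Real.exp (2 * n))

open Classical in
/-- The set `Ω₀` of the vertices at which `|f| > 0`. -/
noncomputable def supp (f : V → ℝ) : Finset V :=
  {x | 0 < |f x|}

open Classical in
/-- `K(A)`: it is `0` if `μ(A) ≤ v₀`, and `v₀⁻¹ μ(A)^(1 - 1/n)` if `μ(A) > v₀`. -/
noncomputable def K (v₀ n : ℝ) (A : Finset V) : ℝ :=
  if Γ.measure A ≤ v₀ then 0 else v₀⁻¹ * Γ.measure A ^ (1 - 1 / n)

open Classical in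
/-- The Sobolev-type inequality for `f`, with `C` in front of the gradient term. The gradient sum
is over the ordered pairs of adjacent vertices. -/
def SobolevIneq (n p c v₀ C : ℝ) (f : V → ℝ) : Prop :=
  C * (∑ x, ∑ y with Γ.graph.Adj x y, |f y - f x| ^ p * Γ.σ x y) ^ (1 / p)
      + c * Γ.K v₀ n (supp f) * (∑ x, |f x| ^ p * Γ.vertexWeight x) ^ (1 / p)
    ≥ c / (2 : ℝ) ^ (1 + 1 / n - 1 / p)
      * (∑ x, |f x| ^ (n * p / (n - p))) ^ ((n - p) / (n * p))

end WeightedGraph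

/-- The vertex set `G - Z(G)` of the noncommuting graph. -/
abbrev NoncentralElement (G : Type*) [Group G] : Type _ :=
  {x : G // x ∉ Subgroup.center G}

noncomputable instance NoncentralElement.instFintype (G : Type*) [Group G] [Finite G] :
    Fintype (NoncentralElement G) :=
  Fintype.ofFinite _

/-- The noncommuting graph `Γ_G`: two noncentral elements are adjacent if they do not commute. -/
def noncommutingGraph (G : Type*) [Group G] : SimpleGraph (NoncentralElement G) where
  Adj x y := ¬ Commute (x : G) (y : G)
  symm := ⟨fun _ _ h h' => h h'.symm⟩
  loopless := ⟨fun x h => h (Commute.refl (x : G))⟩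

/-- `Γ_G` as a weighted graph with unit weights; then `μ_x = deg x` and `σ(∂Ω) = |∂Ω|`. -/
noncomputable def noncommutingWeightedGraph (G : Type*) [Group G] :
    WeightedGraph (NoncentralElement G) :=
  WeightedGraph.unit (noncommutingGraph G)

/-! Centralizers of noncentral elements are proper subgroups. Hence every degree is at least `|V|/2`
and at least 2, and, as two proper subgroups never cover a group, the diameter is at most 2. With
unit weights `ν₂` is the minimum degree, so `|V| ≤ 2n`: for fixed `n` the graphs have bounded size,
and no general isoperimetric theory is needed.

For (a), `μ(Ω) ≤ |V|² ≤ 4n²` while `c · 4n² ≤ 1`, so a single boundary edge suffices.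

For (b), compare the extremes of `|f|`. If the minimum is below half the maximum, a path of at most
two edges has an edge on which `f` varies by at least a quarter of the maximum, and the gradient
term dominates. Otherwise `f` vanishes identically or has full support; in the latter case `v₀ <
μ(V)` makes `K` nonzero, and the second term alone dominates. -/

namespace SimpleGraph

/-- Any two distinct vertices are adjacent or have a common neighbour. -/
def DiamLeTwo {V : Type*} (H : SimpleGraph V) : Prop :=
  ∀ x y, x ≠ y → H.Adj x y ∨ ∃ z, H.Adj x z ∧ H.Adj z y

/-- On a path of at most two edges from `a` to `b`, some edge carries at least half of the drop of
`g`. -/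
theorem DiamLeTwo.exists_adj_half_le {V : Type*} {H : SimpleGraph V} (hH : H.DiamLeTwo)
    (g : V → ℝ) {a b : V} (hab : g b < g a) :
    ∃ x y, H.Adj x y ∧ (g a - g b) / 2 ≤ |g y - g x| := by
  have hne : a ≠ b := by rintro rfl; exact lt_irrefl _ hab
  rcases hH a b hne with h | ⟨z, h₁, h₂⟩
  · exact ⟨b, a, h.symm, by have := le_abs_self (g a - g b); linarith⟩
  · by_cases hz : (g a - g b) / 2 ≤ g a - g z
    · exact ⟨z, a, h₁.symm, hz.trans (le_abs_self _)⟩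
    · exact ⟨b, z, h₂.symm, le_trans (by linarith) (le_abs_self (g z - g b))⟩

theorem DiamLeTwo.exists_adj_mem_notMem {V : Type*} {H : SimpleGraph V} (hH : H.DiamLeTwo)
    {s : Finset V} {a b : V} (ha : a ∈ s) (hb : b ∉ s) :
    ∃ x y, x ∈ s ∧ y ∉ s ∧ H.Adj x y := by
  have hne : a ≠ b := by rintro rfl; exact hb ha
  rcases hH a b hne with h | ⟨z, h₁, h₂⟩
  · exact ⟨a, b, ha, hb, h⟩
  · by_cases hz : z ∈ s
    · exact ⟨z, b, hz, hb, h₂⟩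
    · exact ⟨a, z, ha, hz, h₁⟩

end SimpleGraph

/-! ### Unit weights: degrees, measure, boundary and `ν₂` -/

namespace WeightedGraph

theorem unit_minEdgeWeight {V : Type*} (H : SimpleGraph V) {x y : V} (h : H.Adj x y) : (unit H).minEdgeWeight = 1 := by
  classical
  have : {t | ∃ x y : V, (unit H).graph.Adj x y ∧ t = (unit H).σ x y} = {1} := by
    ext t
    constructor
    · rintro ⟨x, y, hxy, rfl⟩
      exact if_pos hxy
    · rintro rfl
      exact ⟨x, y, h, (if_pos h).symm⟩
  rw [minEdgeWeight, this, csInf_singleton]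

variable {V : Type*} [Fintype V] (H : SimpleGraph V)

open Classical in
theorem unit_vertexWeight (x : V) :
    (unit H).vertexWeight x = (Finset.univ.filter fun y => H.Adj x y).card := by
  have h : ∀ y ∈ Finset.univ.filter (fun y => H.Adj x y), (unit H).σ x y = 1 :=
    fun y hy => if_pos (Finset.mem_filter.1 hy).2
  calc (unit H).vertexWeight x = ∑ y with H.Adj x y, (unit H).σ x y := rfl
    _ = _ := by rw [Finset.sum_congr rfl h]; simp

theorem unit_vertexWeight_le_card (x : V) : (unit H).vertexWeight x ≤ Fintype.card V := by
  classical
  rw [unit_vertexWeight]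
  exact_mod_cast Finset.card_le_univ _

theorem unit_vertexWeight_nonneg (x : V) : 0 ≤ (unit H).vertexWeight x := by
  classical
  rw [unit_vertexWeight]
  positivity

theorem unit_measure_le (Ω : Finset V) : (unit H).measure Ω ≤ (Fintype.card V : ℝ) ^ 2 := by
  calc (unit H).measure Ω ≤ ∑ _x ∈ Ω, (Fintype.card V : ℝ) :=
        Finset.sum_le_sum fun x _ => unit_vertexWeight_le_card H x
    _ = Ω.card * (Fintype.card V : ℝ) := by simp
    _ ≤ (Fintype.card V : ℝ) * Fintype.card V := by
        gcongr
        exact Finset.card_le_univ _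
    _ = _ := by ring

theorem unit_measure_nonneg (Ω : Finset V) : 0 ≤ (unit H).measure Ω :=
  Finset.sum_nonneg fun x _ => unit_vertexWeight_nonneg H x

theorem one_le_unit_boundaryWeight (hH : H.DiamLeTwo) {Ω : Finset V} {a b : V} (ha : a ∈ Ω)
    (hb : b ∉ Ω) : 1 ≤ (unit H).boundaryWeight Ω := by
  classical
  obtain ⟨x, y, hx, hy, h⟩ := hH.exists_adj_mem_notMem ha hb
  have h1 : (unit H).σ x y = 1 := if_pos h
  rw [← h1]
  refine Finset.single_le_sum (f := fun e : V × V => (unit H).σ e.1 e.2) (a := (x, y)) ?_ ?_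
  · intro e _
    simp only [unit]
    split_ifs <;> norm_num
  · simp only [boundary, Finset.mem_filter, Finset.mem_univ, true_and]
    exact ⟨hx, hy, h⟩

/-- Only `ξ` itself is at distance less than 1 from `ξ`. -/
theorem unit_inwardWeight_of_adj {ξ x : V} (h : H.Adj ξ x) :
    (unit H).inwardWeight ξ x = 1 := by
  classical
  have h1 : H.edist ξ x = 1 := SimpleGraph.edist_eq_one_iff_adj.2 h
  have : (Finset.univ.filter fun y =>
      (unit H).graph.Adj x y ∧ (unit H).graph.edist ξ y < (unit H).graph.edist ξ x) = {ξ} := by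
    ext y
    simp only [Finset.mem_filter, Finset.mem_univ, true_and, Finset.mem_singleton]
    change H.Adj x y ∧ H.edist ξ y < H.edist ξ x ↔ _
    rw [h1, Order.lt_one_iff, SimpleGraph.edist_eq_zero_iff]
    constructor
    · exact fun h => h.2.symm
    · rintro rfl
      exact ⟨h.symm, rfl⟩
  rw [inwardWeight]
  convert Finset.sum_singleton (fun y => (unit H).σ x y) ξ
  exact (if_pos h.symm).symm

theorem unit_inwardWeight_self (x : V) : (unit H).inwardWeight x x = 0 := by
  classical
  rw [inwardWeight]
  refine Finset.sum_eq_zero fun y hy => ?_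
  simp at hy

/-- In an unweighted graph without isolated vertices, `ν₂` is the minimum degree. -/
theorem unit_nu_two (hiso : ∀ x, ∃ y, H.Adj x y) : (unit H).nu 2 = (unit H).minVertexWeight := by
  rw [nu, minVertexWeight]
  congr 1
  ext t
  constructor
  · rintro ⟨ξ, x, hx, hpos, rfl⟩
    -- Positive inward weight excludes distance 0, so radius 2 leaves exactly the neighbours of `ξ`.
    have hne : ξ ≠ x := by
      rintro rfl
      exact hpos.ne' (unit_inwardWeight_self H ξ)
    have hadj : H.Adj ξ x := by
      rw [← SimpleGraph.edist_eq_one_iff_adj]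
      refine le_antisymm ?_ ?_
      · have hx' : H.edist ξ x < 2 := hx
        rw [← one_add_one_eq_two] at hx'
        exact Order.le_of_lt_add_one hx'
      · rw [Order.one_le_iff_ne_zero]
        exact fun h => hne (SimpleGraph.edist_eq_zero_iff.1 h)
    exact ⟨x, by rw [unit_inwardWeight_of_adj H hadj, div_one]⟩
  · rintro ⟨x, rfl⟩
    obtain ⟨ξ, h⟩ := hiso x
    refine ⟨ξ, x, ?_, ?_, ?_⟩
    · change H.edist ξ x < _
      rw [SimpleGraph.edist_eq_one_iff_adj.2 h.symm]
      norm_num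
    · rw [unit_inwardWeight_of_adj H h.symm]
      exact one_pos
    · rw [unit_inwardWeight_of_adj H h.symm, div_one]

theorem le_unit_minVertexWeight [Nonempty V] {b : ℝ} (h : ∀ x, b ≤ (unit H).vertexWeight x) :
    b ≤ (unit H).minVertexWeight :=
  le_csInf ⟨_, Classical.arbitrary V, rfl⟩ (by rintro _ ⟨x, rfl⟩; exact h x)

/-! ### Size of `c` and the isoperimetric inequality -/

theorem unit_isoConst_pos_and_le {n : ℝ} (hn : 2 ≤ n) (hedge : ∃ x y, H.Adj x y)
    (hω : (unit H).minVertexWeight = n) (hν : (unit H).nu 2 = n) :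
    0 < (unit H).isoConst 1 1 n ∧ (unit H).isoConst 1 1 n * (4 * n ^ 2) ≤ 1 := by
  obtain ⟨x, y, h⟩ := hedge
  have hn0 : 0 < n := by linarith
  rw [isoConst, unit_minEdgeWeight H h, hω, hν, one_mul, mul_one]
  -- The target `4n²` bounds `μ(Ω)` once `|V| ≤ 2n`. Here `4^(n+3)` absorbs 4, `e^(2n)` absorbs
  -- `n²`, and `ν₂ = n` absorbs `ω^(1/(n-1))`.
  have h4 : (4 : ℝ) ≤ 4 ^ (n + 3) := by
    simpa using Real.rpow_le_rpow_of_exponent_le (x := 4) (by norm_num)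
      (show (1 : ℝ) ≤ n + 3 by linarith)
  have hexp : n ^ 2 ≤ Real.exp (2 * n) := by
    have : n ≤ Real.exp n := by linarith [Real.add_one_le_exp n]
    rw [two_mul, Real.exp_add, sq]
    gcongr
  have hpow : n ^ (1 / (n - 1)) ≤ n := by
    conv_rhs => rw [← Real.rpow_one n]
    refine Real.rpow_le_rpow_of_exponent_le (by linarith) ?_
    rw [div_le_one (by linarith)]
    linarith
  refine ⟨by positivity, ?_⟩
  rw [div_mul_eq_mul_div, div_le_one (by positivity)]
  calc n ^ (1 / (n - 1)) * (4 * n ^ 2) ≤ n * (4 ^ (n + 3) * Real.exp (2 * n)) := by gcongr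
    _ = _ := by ring

theorem unit_isoperimetric (hH : H.DiamLeTwo) {n c : ℝ} (hn : 2 ≤ n)
    (hcard : (Fintype.card V : ℝ) ≤ 2 * n) (hc : 0 < c) (hc1 : c * (4 * n ^ 2) ≤ 1)
    {Ω : Finset V} (hΩ : Ω ≠ Finset.univ) :
    c * (unit H).measure Ω ^ (1 - 1 / n) ≤ (unit H).boundaryWeight Ω := by
  have hn0 : 0 < n := by linarith
  have h1n : 1 / n ≤ 1 := by rw [div_le_one hn0]; linarith
  have h1n' : 1 / n < 1 := by rw [div_lt_one hn0]; linarith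
  obtain ⟨b, hb⟩ : ∃ b, b ∉ Ω := by
    by_contra! h
    exact hΩ (Finset.eq_univ_iff_forall.2 h)
  rcases Ω.eq_empty_or_nonempty with rfl | ⟨a, ha⟩
  -- There is no boundary edge here; the nonzero exponent matters because `0 ^ 0 = 1`.
  · have hexp : 1 - 1 / n ≠ 0 := by linarith
    rw [measure, boundaryWeight, Finset.sum_empty, Real.zero_rpow hexp, mul_zero]
    simp [boundary]
  refine le_trans ?_ (one_le_unit_boundaryWeight H hH ha hb)
  refine le_trans (mul_le_mul_of_nonneg_left ?_ hc.le) hc1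
  have hμ : (unit H).measure Ω ≤ 4 * n ^ 2 := by
    calc _ ≤ (Fintype.card V : ℝ) ^ 2 := unit_measure_le H Ω
      _ ≤ (2 * n) ^ 2 := by gcongr
      _ = _ := by ring
  have h1 : 1 ≤ 4 * n ^ 2 := by nlinarith
  calc _ ≤ (4 * n ^ 2) ^ (1 - 1 / n) :=
        Real.rpow_le_rpow (unit_measure_nonneg H Ω) hμ (by linarith)
    _ ≤ (4 * n ^ 2) ^ (1 : ℝ) :=
        Real.rpow_le_rpow_of_exponent_le h1 (by linarith [show 0 < 1 / n by positivity])
    _ = _ := Real.rpow_one _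

/-! ### The Sobolev inequality -/

open Classical in
theorem abs_sub_le_unit_gradient {p : ℝ} (hp : 0 < p) (f : V → ℝ) {x y : V} (h : H.Adj x y) :
    |f y - f x| ≤ (∑ x, ∑ y with (unit H).graph.Adj x y,
      |f y - f x| ^ p * (unit H).σ x y) ^ (1 / p) := by
  have hσ : ∀ x y, 0 ≤ (unit H).σ x y := fun x y => by
    simp only [unit]
    split_ifs <;> norm_num
  have hnn : ∀ x y, 0 ≤ |f y - f x| ^ p * (unit H).σ x y := fun x y =>
    mul_nonneg (Real.rpow_nonneg (abs_nonneg _) _) (hσ x y)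
  have h1 : (unit H).σ x y = 1 := if_pos h
  have key : |f y - f x| ^ p ≤ ∑ x, ∑ y with (unit H).graph.Adj x y,
      |f y - f x| ^ p * (unit H).σ x y := by
    calc |f y - f x| ^ p = |f y - f x| ^ p * (unit H).σ x y := by rw [h1, mul_one]
      _ ≤ ∑ y with (unit H).graph.Adj x y, |f y - f x| ^ p * (unit H).σ x y :=
          Finset.single_le_sum (f := fun y => |f y - f x| ^ p * (unit H).σ x y)
            (fun y _ => hnn x y) (Finset.mem_filter.2 ⟨Finset.mem_univ _, h⟩)
      _ ≤ _ := Finset.single_le_sum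
            (f := fun x => ∑ y with (unit H).graph.Adj x y, |f y - f x| ^ p * (unit H).σ x y)
            (fun x _ => Finset.sum_nonneg fun y _ => hnn x y) (Finset.mem_univ x)
  calc |f y - f x| = (|f y - f x| ^ p) ^ (1 / p) := by
        rw [one_div, Real.rpow_rpow_inv (abs_nonneg _) hp.ne']
    _ ≤ _ := Real.rpow_le_rpow (Real.rpow_nonneg (abs_nonneg _) _) key (by positivity)

/-- The constant in front of the gradient term. -/
noncomputable def gradConst (n p : ℝ) : ℝ :=
  4 * (2 : ℝ) ^ (1 / p) * (2 * |n| + 1) ^ (1 / p)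

theorem gradConst_pos (n p : ℝ) : 0 < gradConst n p := by
  unfold gradConst
  positivity

theorem sum_abs_rpow_le {q M : ℝ} (hq : 0 < q) (hM : 0 ≤ M) {f : V → ℝ} (hf : ∀ x, |f x| ≤ M) :
    (∑ x, |f x| ^ q) ^ (1 / q) ≤ (Fintype.card V : ℝ) ^ (1 / q) * M := by
  calc (∑ x, |f x| ^ q) ^ (1 / q) ≤ ((Fintype.card V : ℝ) * M ^ q) ^ (1 / q) := by
        refine Real.rpow_le_rpow (Finset.sum_nonneg fun x _ => by positivity) ?_ (by positivity)
        calc ∑ x, |f x| ^ q ≤ ∑ _x : V, M ^ q :=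
              Finset.sum_le_sum fun x _ => Real.rpow_le_rpow (abs_nonneg _) (hf x) hq.le
          _ = _ := by simp
    _ = _ := by
        rw [Real.mul_rpow (by positivity) (by positivity), one_div, Real.rpow_rpow_inv hM hq.ne']

theorem le_sum_abs_rpow_mul {p m : ℝ} (hp : 0 < p) (hm : 0 ≤ m) {f : V → ℝ}
    (hf : ∀ x, m ≤ |f x|) :
    (unit H).measure Finset.univ ^ (1 / p) * m ≤
      (∑ x, |f x| ^ p * (unit H).vertexWeight x) ^ (1 / p) := by
  have hμ := unit_measure_nonneg H Finset.univ
  calc _ = ((unit H).measure Finset.univ * m ^ p) ^ (1 / p) := by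
        rw [Real.mul_rpow hμ (by positivity), one_div, Real.rpow_rpow_inv hm hp.ne']
    _ ≤ _ := by
        refine Real.rpow_le_rpow (by positivity) ?_ (by positivity)
        rw [measure, Finset.sum_mul]
        refine Finset.sum_le_sum fun x _ => ?_
        rw [mul_comm]
        exact mul_le_mul_of_nonneg_right (Real.rpow_le_rpow hm (hf x) hp.le)
          (unit_vertexWeight_nonneg H x)

theorem unit_sobolevIneq [Nonempty V] (hH : H.DiamLeTwo) {n c : ℝ} (hn : 2 ≤ n)
    (hcard : (Fintype.card V : ℝ) ≤ 2 * n) (hdeg : ∀ x, 2 ≤ (unit H).vertexWeight x)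
    (hc : 0 < c) (hc1 : c ≤ 1) {v₀ : ℝ} (hv : 0 < v₀)
    (hvμ : v₀ < (unit H).measure Finset.univ) {p : ℝ} (hp : 0 < p) (hpn : p < n) (f : V → ℝ) :
    (unit H).SobolevIneq n p c v₀ (gradConst n p) f := by
  classical
  have hn0 : 0 < n := by linarith
  -- `s` is the reciprocal of the exponent `np/(n-p)`, and the factor on the right becomes `c · 2^s
  -- / 2`.
  set s : ℝ := 1 / p - 1 / n with hs
  have hs0 : 0 < s := sub_pos.2 (one_div_lt_one_div_of_lt hp hpn)
  have hsp : s ≤ 1 / p := by linarith [show 0 < 1 / n by positivity]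
  have hnp : 0 < n - p := by linarith
  have hq1 : (n - p) / (n * p) = 1 / (n * p / (n - p)) := by rw [one_div_div]
  have hqs : 1 / (n * p / (n - p)) = s := by rw [one_div_div, hs]; field_simp
  have hq : 0 < n * p / (n - p) := by positivity
  obtain ⟨a, ha⟩ := Finite.exists_max fun x => |f x|
  obtain ⟨b, hb⟩ := Finite.exists_min fun x => |f x|
  have hN0 : 0 ≤ (Fintype.card V : ℝ) := by positivity
  have hrhs := sum_abs_rpow_le hq (abs_nonneg (f a)) ha
  rw [hqs] at hrhs
  have hpow : c / (2 : ℝ) ^ (1 + 1 / n - 1 / p) = c * (2 ^ s / 2) := by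
    rw [show 1 + 1 / n - 1 / p = 1 - s by rw [hs]; ring, Real.rpow_sub two_pos, Real.rpow_one]
    field_simp
  have hK : 0 ≤ (unit H).K v₀ n (supp f) := by
    rw [K]
    split_ifs
    · exact le_rfl
    · have := unit_measure_nonneg H (supp f)
      positivity
  unfold SobolevIneq
  rw [hq1, hqs, hpow, ge_iff_le]
  set E := (∑ x, ∑ y with (unit H).graph.Adj x y, |f y - f x| ^ p * (unit H).σ x y) ^ (1 / p)
    with hE
  have hE0 : 0 ≤ E := by
    refine Real.rpow_nonneg (Finset.sum_nonneg fun x _ => Finset.sum_nonneg fun y hy => ?_) _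
    have := (unit H).σ_pos x y (Finset.mem_filter.1 hy).2
    positivity
  have hF0 : 0 ≤ (∑ x, |f x| ^ p * (unit H).vertexWeight x) ^ (1 / p) := by
    refine Real.rpow_nonneg (Finset.sum_nonneg fun x _ => ?_) _
    have := unit_vertexWeight_nonneg H x
    positivity
  have hC := gradConst_pos n p
  rcases lt_or_ge (|f b|) (|f a| / 2) with hlt | hge
  · have hfa : 0 < |f a| := by linarith [abs_nonneg (f b)]
    obtain ⟨x, y, hxy, hd⟩ := hH.exists_adj_half_le (fun x => |f x|)
      (show |f b| < |f a| by linarith)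
    have hgrad : |f a| / 4 ≤ E := by
      calc |f a| / 4 ≤ (|f a| - |f b|) / 2 := by linarith
        _ ≤ _ := hd
        _ ≤ |f y - f x| := abs_abs_sub_abs_le _ _
        _ ≤ E := by rw [hE]; convert abs_sub_le_unit_gradient H hp f hxy
    have hcs : (Fintype.card V : ℝ) ^ s ≤ (2 * |n| + 1) ^ (1 / p) := by
      rw [abs_of_pos hn0]
      calc (Fintype.card V : ℝ) ^ s ≤ (2 * n + 1) ^ s :=
            Real.rpow_le_rpow hN0 (by linarith) hs0.le
        _ ≤ _ := Real.rpow_le_rpow_of_exponent_le (by linarith) hsp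
    have h2s : (2 : ℝ) ^ s / 2 ≤ 2 ^ (1 / p) := by
      have := Real.rpow_le_rpow_of_exponent_le one_le_two hsp
      have h0 : (0 : ℝ) < 2 ^ s := by positivity
      linarith
    calc _ ≤ c * (2 ^ s / 2) * ((Fintype.card V : ℝ) ^ s * |f a|) := by gcongr
      _ ≤ 1 * 2 ^ (1 / p) * ((2 * |n| + 1) ^ (1 / p) * |f a|) := by gcongr
      -- The 4 undoes the quarter in `hgrad`; the other two factors of the constant bound `2^s / 2`
      -- and `|V|^s`.
      _ = gradConst n p * (|f a| / 4) := by rw [gradConst]; ring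
      _ ≤ gradConst n p * E := by gcongr
      _ ≤ _ := le_add_of_nonneg_right (by positivity)
  · rcases (abs_nonneg (f a)).eq_or_lt with h0 | hfa
    · rw [← h0, mul_zero] at hrhs
      calc _ ≤ c * (2 ^ s / 2) * 0 := by gcongr
        _ = 0 := mul_zero _
        _ ≤ _ := by positivity
    have hsupp : supp f = Finset.univ := by
      rw [supp, Finset.filter_eq_self]
      intro x _
      linarith [hb x]
    set μ := (unit H).measure Finset.univ with hμ
    have hμ0 : 0 < μ := hv.trans hvμ
    have hμcard : 2 * (Fintype.card V : ℝ) ≤ μ := by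
      calc 2 * (Fintype.card V : ℝ) = ∑ _x : V, (2 : ℝ) := by simp [mul_comm]
        _ ≤ μ := Finset.sum_le_sum fun x _ => hdeg x
    have hlow := le_sum_abs_rpow_mul H hp (by positivity) (fun x => hge.trans (hb x))
    -- Since `v₀ < μ`, replacing `v₀⁻¹` by `μ⁻¹` only decreases `K`.
    have hKval : μ ^ (-(1 / n)) ≤ (unit H).K v₀ n (supp f) := by
      rw [hsupp, K, if_neg (not_le.2 hvμ), ← hμ]
      calc μ ^ (-(1 / n)) = μ⁻¹ * μ ^ (1 - 1 / n) := by
            rw [← Real.rpow_neg_one μ, ← Real.rpow_add hμ0]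
            congr 1
            ring
        _ ≤ _ := by gcongr
    calc _ ≤ c * (2 ^ s / 2) * ((Fintype.card V : ℝ) ^ s * |f a|) := by gcongr
      _ = c * ((2 * (Fintype.card V : ℝ)) ^ s * (|f a| / 2)) := by
          rw [Real.mul_rpow two_pos.le hN0]; ring
      -- Degrees at least 2 give `2|V| ≤ μ`, which pays exactly for the factor `2^s`.
      _ ≤ c * (μ ^ s * (|f a| / 2)) := by gcongr
      _ = c * μ ^ (-(1 / n)) * (μ ^ (1 / p) * (|f a| / 2)) := by
          rw [show s = -(1 / n) + 1 / p by rw [hs]; ring, Real.rpow_add hμ0]; ring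
      _ ≤ _ := by gcongr
      _ ≤ _ := le_add_of_nonneg_left (by positivity)

end WeightedGraph

/-! ### Centralizers and the noncommuting graph -/

section NoncommutingGraph

variable {G : Type*} [Group G]

theorem notMem_center_of_not_commute {g h : G} (hgh : ¬ Commute g h) :
    g ∉ Subgroup.center G :=
  fun hg => hgh (Subgroup.mem_center_iff.1 hg h).symm

theorem exists_not_commute_of_notMem_center {g : G} (hg : g ∉ Subgroup.center G) :
    ∃ h : G, ¬ Commute g h := by
  by_contra! hc
  exact hg (Subgroup.mem_center_iff.2 fun h => (hc h).eq.symm)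

theorem not_commute_mul_right {g h k : G} (hgh : Commute g h) (hgk : ¬ Commute g k) :
    ¬ Commute g (k * h) := by
  intro hc
  apply hgk
  simpa using hc.mul_right hgh.inv_right

theorem not_commute_mul_left {g h k : G} (hgh : Commute g h) (hgk : ¬ Commute g k) :
    ¬ Commute g (h * k) := by
  intro hc
  apply hgk
  simpa using hgh.inv_right.mul_right hc

theorem noncommutingGraph_exists_adj (x : NoncentralElement G) :
    ∃ y, (noncommutingGraph G).Adj x y := by
  obtain ⟨h, hh⟩ := exists_not_commute_of_notMem_center x.2
  exact ⟨⟨h, notMem_center_of_not_commute fun hc => hh hc.symm⟩, hh⟩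

theorem noncommutingGraph_diamLeTwo : (noncommutingGraph G).DiamLeTwo := by
  intro x y _
  have mk : ∀ z : G, ¬ Commute (x : G) z → ¬ Commute (y : G) z →
      ∃ z, (noncommutingGraph G).Adj x z ∧ (noncommutingGraph G).Adj z y := fun z hx hy =>
    ⟨⟨z, notMem_center_of_not_commute fun hc => hx hc.symm⟩, hx, fun hc => hy hc.symm⟩
  right
  obtain ⟨z, hz⟩ := exists_not_commute_of_notMem_center x.2
  obtain ⟨w, hw⟩ := exists_not_commute_of_notMem_center y.2
  by_cases hyz : Commute (y : G) z
  · by_cases hxw : Commute (x : G) w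
    -- `z` lies only in the centralizer of `y` and `w` only in that of `x`, so `z * w` lies in
    -- neither.
    · exact mk (z * w) (not_commute_mul_right hxw hz) (not_commute_mul_left hyz hw)
    · exact mk w hxw hw
  · exact mk z hz hyz

variable [Finite G]

/-- If `y` is a neighbour of `x`, so is `y * x`, and they differ because `x ≠ 1`. -/
theorem two_le_noncommutingGraph_vertexWeight (x : NoncentralElement G) :
    2 ≤ (noncommutingWeightedGraph G).vertexWeight x := by
  classical
  rw [noncommutingWeightedGraph, WeightedGraph.unit_vertexWeight]
  obtain ⟨y, hy⟩ := noncommutingGraph_exists_adj x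
  have hyx : ¬ Commute (x : G) (y * x) := not_commute_mul_right (Commute.refl _) hy
  let z : NoncentralElement G :=
    ⟨y * x, notMem_center_of_not_commute fun hc => hyx hc.symm⟩
  have hne : y ≠ z := by
    intro h
    have h1 : (y : G) = y * x := congrArg Subtype.val h
    have h2 : (x : G) = 1 := by simpa using h1
    exact x.2 (h2 ▸ Subgroup.one_mem _)
  have hsub : ({y, z} : Finset (NoncentralElement G)) ⊆
      Finset.univ.filter fun y => (noncommutingGraph G).Adj x y := by
    intro u hu
    rw [Finset.mem_insert, Finset.mem_singleton] at hu
    rw [Finset.mem_filter]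
    rcases hu with rfl | rfl
    · exact ⟨Finset.mem_univ _, hy⟩
    · exact ⟨Finset.mem_univ _, hyx⟩
  have := Finset.card_le_card hsub
  rw [Finset.card_pair hne] at this
  exact_mod_cast this

/-- Left translation by a neighbour `z` of `x` injects the non-neighbours of `x` into its
neighbours. -/
theorem card_le_two_mul_noncommutingGraph_vertexWeight (x : NoncentralElement G) :
    (Fintype.card (NoncentralElement G) : ℝ) ≤
      2 * (noncommutingWeightedGraph G).vertexWeight x := by
  classical
  rw [noncommutingWeightedGraph, WeightedGraph.unit_vertexWeight]
  obtain ⟨z, hz⟩ := noncommutingGraph_exists_adj x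
  have hz' : ¬ Commute (x : G) z := hz
  have key : (Finset.univ.filter fun y => ¬ (noncommutingGraph G).Adj x y).card ≤
      (Finset.univ.filter fun y => (noncommutingGraph G).Adj x y).card := by
    have hmul : ∀ y ∈ Finset.univ.filter (fun y => ¬ (noncommutingGraph G).Adj x y),
        ¬ Commute (x : G) (z * y) := fun y hy =>
      not_commute_mul_right (not_not.1 (Finset.mem_filter.1 hy).2) hz'
    refine Finset.card_le_card_of_injOn
      -- The value `x` is a dummy: on non-neighbours of `x` the product is never central.
      (fun y => if h : (z * y : G) ∉ Subgroup.center G then ⟨z * y, h⟩ else x) ?_ ?_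
    · intro y hy
      have hc := hmul y hy
      have hm := notMem_center_of_not_commute fun h => hc h.symm
      simp only [dif_pos hm, Finset.coe_filter, Finset.mem_univ, true_and, Set.mem_ofPred_eq]
      exact hc
    · intro y hy w hw h
      have hm := notMem_center_of_not_commute fun h => hmul y hy h.symm
      have hm' := notMem_center_of_not_commute fun h => hmul w hw h.symm
      simp only [dif_pos hm, dif_pos hm', Subtype.mk.injEq, mul_right_inj] at h
      exact Subtype.ext h
  have hsplit := Finset.card_filter_add_card_filter_not (s := Finset.univ)
    (fun y => (noncommutingGraph G).Adj x y)
  rw [Finset.card_univ] at hsplit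
  have : Fintype.card (NoncentralElement G) ≤
      2 * (Finset.univ.filter fun y => (noncommutingGraph G).Adj x y).card := by omega
  exact_mod_cast this

end NoncommutingGraph

theorem corollary2p8 :
    ∃ C : ℝ → ℝ → ℝ, (∀ n p : ℝ, 0 < C n p) ∧
      ∀ (G : Type*) [Group G] [Finite G], (∃ a b : G, a * b ≠ b * a) →
        ∀ (Γ : WeightedGraph (NoncentralElement G)) (n c : ℝ),
          Γ = noncommutingWeightedGraph G →
          n = Γ.nu 2 →
          c = Γ.isoConst 1 1 n →
          1 < n ∧ 0 < c ∧
          ∀ Ω : Finset (NoncentralElement G), Ω ≠ Finset.univ →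
            Γ.boundaryWeight Ω ≥ c * Γ.measure Ω ^ (1 - 1 / n) ∧
            ∀ v₀ : ℝ, v₀ = 1 + Γ.measure Ω →
              ∀ p : ℝ, 0 < p → p < n →
                ∀ f : NoncentralElement G → ℝ,
                  Γ.SobolevIneq n p c v₀ (C n p) f := by
  refine ⟨WeightedGraph.gradConst, WeightedGraph.gradConst_pos, ?_⟩
  rintro G _ _ ⟨a, b, hab⟩ Γ n c rfl hn hc
  classical
  let x₀ : NoncentralElement G := ⟨a, notMem_center_of_not_commute hab⟩
  have : Nonempty (NoncentralElement G) := ⟨x₀⟩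
  have hdeg := two_le_noncommutingGraph_vertexWeight (G := G)
  have hcard := card_le_two_mul_noncommutingGraph_vertexWeight (G := G)
  have hdiam := noncommutingGraph_diamLeTwo (G := G)
  rw [noncommutingWeightedGraph] at *
  have hω : n = (WeightedGraph.unit (noncommutingGraph G)).minVertexWeight :=
    hn.trans (WeightedGraph.unit_nu_two _ noncommutingGraph_exists_adj)
  have hn2 : 2 ≤ n := hω ▸ WeightedGraph.le_unit_minVertexWeight _ hdeg
  have hcard' : (Fintype.card (NoncentralElement G) : ℝ) ≤ 2 * n := by
    have : (Fintype.card (NoncentralElement G) : ℝ) / 2 ≤ n :=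
      hω ▸ WeightedGraph.le_unit_minVertexWeight _ fun x => by linarith [hcard x]
    linarith
  obtain ⟨hc0, hc1⟩ := WeightedGraph.unit_isoConst_pos_and_le (noncommutingGraph G) hn2
    ⟨x₀, noncommutingGraph_exists_adj x₀⟩ hω.symm hn.symm
  rw [← hc] at hc0 hc1
  have hc_le : c ≤ 1 := by nlinarith
  refine ⟨by linarith, hc0, fun Ω hΩ =>
    ⟨WeightedGraph.unit_isoperimetric _ hdiam hn2 hcard' hc0 hc1 hΩ, ?_⟩⟩
  rintro v₀ rfl p hp hpn f
  have hμ0 := WeightedGraph.unit_measure_nonneg (noncommutingGraph G) Ω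
  refine WeightedGraph.unit_sobolevIneq _ hdiam hn2 hcard' hdeg hc0 hc_le (by linarith) ?_ hp hpn f
  -- A vertex outside `Ω` adds at least 2 to the measure, more than the 1 in `v₀`, so `v₀ < μ(V)`.
  obtain ⟨y, hy⟩ : ∃ y, y ∉ Ω := by
    by_contra! h
    exact hΩ (Finset.eq_univ_iff_forall.2 h)
  have hins : (WeightedGraph.unit (noncommutingGraph G)).measure (insert y Ω) ≤
      (WeightedGraph.unit (noncommutingGraph G)).measure Finset.univ :=
    Finset.sum_le_sum_of_subset_of_nonneg (Finset.subset_univ _)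
      fun x _ _ => WeightedGraph.unit_vertexWeight_nonneg _ x
  have hsum : (WeightedGraph.unit (noncommutingGraph G)).measure (insert y Ω) =
      (WeightedGraph.unit (noncommutingGraph G)).vertexWeight y +
        (WeightedGraph.unit (noncommutingGraph G)).measure Ω := Finset.sum_insert hy
  linarith [hdeg y]
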